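/- Let $\mathbb{C}[z]=\mathbb{C}[z_1,z_2,\dots]$ be the ring of complex polynomials in countably many variables, let $p_1<p_2<\cdots$ be the primes, and for a finitely supported multi-index $\kappa=(\kappa_1,\kappa_2,\dots)$ of non-negative integers write $z^\kappa=\prod_j z_j^{\kappa_j}$ and $p^\kappa=\prod_j p_j^{\kappa_j}$. Let $\alpha=\{\alpha(n)\}_{n\ge1}$ be a sequence of complex numbers, and let $$[f,g]=\sum_{\kappa,\kappa'} f_\kappa\, g_{\kappa'}\,\alpha(p^{\kappa}p^{\kappa'}),\qquad f=\sum_\kappa f_\kappa z^\kappa,\quad g=\sum_\kappa g_\kappa z^\kappa\in\mathbb{C}[z],$$ be the associated Helson form. The form has *finite rank* if its kernel $\{f\in\mathbb{C}[z]: [f,g]=0 \text{ for all } g\in\mathbb{C}[z]\}$ has finite codimension in $\mathbb{C}[z]$; it is *bounded* if the matrix $\{\alpha(nm)\}_{n,m\ge1}$ is the matrix of a bounded operator on $\ell^2(\mathbb{N})$, $\mathbb{N}=\{1,2,\dots\}$. For a sequence $c=\{c(j)\}_{j\ge1}$ of complex numbers let $D(c)f=\sum_{j\ge1}c(j)\,\partial_{z_j}f$,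 $f\in\mathbb{C}[z]$. A *factorizable differential operator* is either multiplication by a complex constant (order $0$; it has no directions) or a product $\mathbf{D}(\mathbf{c})=D(c_1)\cdots D(c_M)$, $M\ge1$, with non-zero sequences $c_1,\dots,c_M$, called its directions; $\mathbf{c}\in\ell^2$ means that all directions belong to $\ell^2(\mathbb{N})$. Then: (i) The form $[\cdot,\cdot]$ has finite rank if and only if it can be represented as a finite sum $$[f,g]=\sum_{\ell}\mathbf{D}(\mathbf{c}^{(\ell)})(fg)(\lambda^{(\ell)}),\qquad f,g\in\mathbb{C}[z],\qquad (*)$$ where each $\mathbf{D}(\mathbf{c}^{(\ell)})$ is a factorizable differential operator and $\lambda^{(\ell)}\in\mathbb{C}^\infty$ (the space of all complex sequences). (ii) The form $[\cdot,\cdot]$ is bounded and of finite rank if and only if the representation $(*)$ can be chosen such that, for all $\ell$, $\lambda^{(\ell)}\in\mathbb{D}^\infty\cap\ell^2$ (i.e. $\lambda^{(\ell)}\in\ell^2(\mathbb{N})$ and all its entries have modulus less than $1$) and $\mathbf{c}^{(\ell)}\in\ell^2$. -/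

import Mathlib

namespace Helson

/-- The ring `ℂ[z]` of complex polynomials in countably many variables `z_0, z_1, …`. -/
abbrev Poly : Type := MvPolynomial ℕ ℂ

/-- The monotone enumeration `p_0 = 2, p_1 = 3, p_2 = 5, …` of the primes. -/
noncomputable def prime (j : ℕ) : ℕ+ :=
  ⟨Nat.nth Nat.Prime j, (Nat.prime_nth_prime j).pos⟩

/-- The positive integer `p^κ = ∏ j, p_j ^ κ_j` of a finitely supported multi-index `κ`. -/
noncomputable def toNat (κ : ℕ →₀ ℕ) : ℕ+ :=
  κ.prod fun j k => prime j ^ k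

/-- The Helson form of the sequence `α`, as a bilinear form on `ℂ[z]`:
`[f, g]_α = ∑ f_κ g_κ' α(p^κ p^κ')`, the sums running over the monomials of `f` and of `g`. -/
noncomputable def form (α : ℕ+ → ℂ) : LinearMap.BilinForm ℂ Poly :=
  LinearMap.mk₂ ℂ
    (fun f g => ∑ κ ∈ f.support, ∑ κ' ∈ g.support,
      f.coeff κ * g.coeff κ' * α (toNat κ * toNat κ'))
    (by
      intro f₁ f₂ g
      classical
      have h : ∀ f : Poly, f.support ⊆ f₁.support ∪ f₂.support →
          (∑ κ ∈ f.support, ∑ κ' ∈ g.support,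
            f.coeff κ * g.coeff κ' * α (toNat κ * toNat κ')) =
          ∑ κ ∈ f₁.support ∪ f₂.support, ∑ κ' ∈ g.support,
            f.coeff κ * g.coeff κ' * α (toNat κ * toNat κ') := by
        intro f hf
        refine Finset.sum_subset hf fun κ _ hκ => ?_
        simp [MvPolynomial.notMem_support_iff.mp hκ]
      rw [h _ MvPolynomial.support_add, h _ Finset.subset_union_left,
        h _ Finset.subset_union_right]
      simp only [← Finset.sum_add_distrib, MvPolynomial.coeff_add, add_mul])
    (by
      intro a f g
      have h : (a • f).support ⊆ f.support := MvPolynomial.support_smul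
      rw [Finset.sum_subset h fun κ _ hκ => by
        simp [MvPolynomial.notMem_support_iff.mp hκ]]
      simp only [smul_eq_mul, Finset.mul_sum, MvPolynomial.coeff_smul, mul_assoc])
    (by
      intro f g₁ g₂
      classical
      rw [← Finset.sum_add_distrib]
      refine Finset.sum_congr rfl fun κ _ => ?_
      have h : ∀ g : Poly, g.support ⊆ g₁.support ∪ g₂.support →
          (∑ κ' ∈ g.support, f.coeff κ * g.coeff κ' * α (toNat κ * toNat κ')) =
          ∑ κ' ∈ g₁.support ∪ g₂.support,
            f.coeff κ * g.coeff κ' * α (toNat κ * toNat κ') := by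
        intro g hg
        refine Finset.sum_subset hg fun κ' _ hκ' => ?_
        simp [MvPolynomial.notMem_support_iff.mp hκ']
      rw [h _ MvPolynomial.support_add, h _ Finset.subset_union_left,
        h _ Finset.subset_union_right]
      simp only [← Finset.sum_add_distrib, MvPolynomial.coeff_add, mul_add, add_mul])
    (by
      intro a f g
      rw [Finset.smul_sum]
      refine Finset.sum_congr rfl fun κ _ => ?_
      have h : (a • g).support ⊆ g.support := MvPolynomial.support_smul
      rw [Finset.sum_subset h fun κ' _ hκ' => by
        simp [MvPolynomial.notMem_support_iff.mp hκ']]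
      simp only [smul_eq_mul, Finset.mul_sum, MvPolynomial.coeff_smul]
      exact Finset.sum_congr rfl fun κ' _ => by ring)

/-- The kernel `{f | ∀ g, [f, g]_α = 0}` has finite codimension in `ℂ[z]`. -/
def HasFiniteRank (α : ℕ+ → ℂ) : Prop :=
  FiniteDimensional ℂ (Poly ⧸ LinearMap.ker (form α))

/-- The Helson matrix `M(α) = (α(nm))_{n,m ≥ 1}` is the matrix, in the standard basis, of a
bounded operator on `ℓ²(ℕ)`, where `ℕ = {1, 2, …}`. -/
def IsBounded (α : ℕ+ → ℂ) : Prop :=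
  ∃ T : lp (fun _ : ℕ+ => ℂ) 2 →L[ℂ] lp (fun _ : ℕ+ => ℂ) 2,
    ∀ n m : ℕ+, T (lp.single 2 m (1 : ℂ)) n = α (n * m)

/-- The first order differential operator `D(c) f = ∑ j, c(j) ∂f/∂z_j`. Only the finitely many
variables that occur in `f` contribute. -/
noncomputable def dirDeriv (c : ℕ → ℂ) (f : Poly) : Poly :=
  ∑ j ∈ f.vars, c j • MvPolynomial.pderiv j f

/-- Factorizable differential operators: multiplication by a constant (order `0`), and products
`D(c_1) ⋯ D(c_M)` with non-zero directions `c_1, …, c_M`. (The empty product is the identity,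
i.e. multiplication by `1`.) -/
inductive FactorizableOp : Type
  | const (a : ℂ) : FactorizableOp
  | prod (cs : List (ℕ → ℂ)) (hcs : ∀ c ∈ cs, c ≠ 0) : FactorizableOp

/-- The action of a factorizable differential operator on polynomials. -/
noncomputable def FactorizableOp.apply : FactorizableOp → Poly → Poly
  | .const a, f => a • f
  | .prod cs _, f => cs.foldr dirDeriv f

/-- The directions of differentiation of a factorizable differential operator. -/
def FactorizableOp.directions : FactorizableOp → List (ℕ → ℂ)
  | .const _ => []
  | .prod cs _ => cs

/-- `[f, g]_α = ∑ l, D_l(fg)(lam_l)` for all polynomials `f`, `g`. -/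
def IsRepresentation (α : ℕ+ → ℂ) {L : ℕ} (D : Fin L → FactorizableOp)
    (lam : Fin L → ℕ → ℂ) : Prop :=
  ∀ f g : Poly, form α f g = ∑ l, MvPolynomial.eval (lam l) ((D l).apply (f * g))

end Helson

namespace Helson

/-! The form is `symbol α` evaluated at the product `f * g`, so the question is when this functional
lies in a span `pointFunctionals P Q` of derivatives at points; by `mem_pointFunctionals_iff` such
membership is exactly the representation (*), with `P` and `Q` constraining points and directions.

A representation gives finite rank by the Leibniz rule (`exists_sum_mul_of_mem_pointFunctionals`).
Conversely, the kernel is an ideal, and the symbol factors through the finite-dimensional algebra A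
= ℂ[z]/ker. As an ideal, A is generated by the annihilators of powers of its maximal ideals, and
multiplied by such an annihilating element the quotient map becomes a finite Taylor expansion at a
character of A (`comp_algHom_mem_pointFunctionals`). The points are (χ(z_j)) for characters χ, and
the directions are (ξ(z_j)) for ξ in the dual of A.

The form is nondegenerate on A, so every functional on A is some [f, ·]. If the form is bounded, the
values of [f, ·] on distinct monomials are square summable. Hence points and directions lie in ℓ²,
and square summability of the powers w_j^k in k forces |w_j| < 1. Conversely, for such points and
directions the Leibniz factors have square summable coefficients: a Cauchy-type estimate
(`majorant_dirDerivation_le`) bounds a derivative of z^κ by C s^κ with s still in the ball, and the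
Euler product makes ∑ s^(2κ) finite. The matrix is then a finite sum of rank-one operators on ℓ². -/

open MvPolynomial

/-! ### Factorizable operators and the span of point functionals -/

/-- The derivation `D(c)` of `ℂ[z]`. -/
noncomputable def dirDerivation (c : ℕ → ℂ) : Derivation ℂ Poly Poly :=
  mkDerivation ℂ fun j => C (c j)

/-- With the index set `f.vars` frozen, the sum is itself a derivation, and a derivation is
determined at `f` by its values on the variables of `f`. -/
theorem dirDeriv_eq_dirDerivation (c : ℕ → ℂ) (f : Poly) :
    dirDeriv c f = dirDerivation c f := by
  classical
  have hs : ∀ g : Poly, (∑ j ∈ f.vars, c j • pderiv (R := ℂ) j) g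
      = ∑ j ∈ f.vars, c j • pderiv j g := fun g => by
    have := map_sum (Derivation.coeFnAddMonoidHom (R := ℂ) (A := Poly) (M := Poly))
      (fun j => c j • pderiv j) f.vars
    exact (congrFun this g).trans (by simp [Finset.sum_apply])
  have h : (∑ j ∈ f.vars, c j • pderiv (R := ℂ) j) f = dirDerivation c f := by
    refine derivation_eq_of_forall_mem_vars fun i hi => ?_
    rw [hs, Finset.sum_eq_single i]
    · simp [dirDerivation, mkDerivation_X, smul_eq_C_mul]
    · intro j _ hj
      simp [pderiv_X_of_ne hj.symm]
    · exact fun h => absurd hi h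
  rw [← h, hs]
  rfl

theorem dirDerivation_X (c : ℕ → ℂ) (j : ℕ) : dirDerivation c (X j) = C (c j) :=
  mkDerivation_X ..

theorem dirDerivation_X_mul (c : ℕ → ℂ) (j : ℕ) (f : Poly) :
    dirDerivation c (X j * f) = c j • f + X j * dirDerivation c f := by
  rw [Derivation.leibniz, dirDerivation_X, smul_eq_mul, smul_eq_mul, smul_eq_C_mul]
  ring

theorem dirDerivation_zero (f : Poly) : dirDerivation 0 f = 0 := by
  rw [← dirDeriv_eq_dirDerivation]
  simp [dirDeriv]

theorem dirDerivation_smul (a : ℂ) (c : ℕ → ℂ) (f : Poly) :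
    dirDerivation (a • c) f = a • dirDerivation c f := by
  simp only [← dirDeriv_eq_dirDerivation, dirDeriv, Finset.smul_sum, Pi.smul_apply, smul_assoc]

/-- The product `D(c₁) ⋯ D(c_M)` as a linear map. -/
noncomputable def iterDeriv : List (ℕ → ℂ) → Poly →ₗ[ℂ] Poly
  | [] => LinearMap.id
  | c :: cs => (dirDerivation c : Poly →ₗ[ℂ] Poly) ∘ₗ iterDeriv cs

theorem iterDeriv_nil (f : Poly) : iterDeriv [] f = f := rfl

theorem iterDeriv_cons (c : ℕ → ℂ) (cs : List (ℕ → ℂ)) (f : Poly) :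
    iterDeriv (c :: cs) f = dirDerivation c (iterDeriv cs f) := rfl

theorem iterDeriv_eq_foldr (cs : List (ℕ → ℂ)) (f : Poly) :
    iterDeriv cs f = cs.foldr dirDeriv f := by
  induction cs with
  | nil => rfl
  | cons c cs ih => rw [iterDeriv_cons, ih, List.foldr_cons, dirDeriv_eq_dirDerivation]

theorem iterDeriv_concat (c : ℕ → ℂ) (cs : List (ℕ → ℂ)) (f : Poly) :
    iterDeriv (cs ++ [c]) f = iterDeriv cs (dirDerivation c f) := by
  simp [iterDeriv_eq_foldr, dirDeriv_eq_dirDerivation]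

theorem iterDeriv_eq_zero_of_mem {cs : List (ℕ → ℂ)} (h : (0 : ℕ → ℂ) ∈ cs) (f : Poly) :
    iterDeriv cs f = 0 := by
  induction cs with
  | nil => simp at h
  | cons c cs ih =>
    rw [iterDeriv_cons]
    rcases List.mem_cons.mp h with rfl | h
    · exact dirDerivation_zero _
    · rw [ih h, map_zero]

/-- The functional `f ↦ (D(c₁) ⋯ D(c_M) f)(w)`. -/
noncomputable def evalIterDeriv (w : ℕ → ℂ) (cs : List (ℕ → ℂ)) : Module.Dual ℂ Poly :=
  (aeval w).toLinearMap ∘ₗ iterDeriv cs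

theorem evalIterDeriv_apply (w : ℕ → ℂ) (cs : List (ℕ → ℂ)) (f : Poly) :
    evalIterDeriv w cs f = eval w (iterDeriv cs f) := by
  simp [evalIterDeriv, aeval_eq_eval]

/-- The span of the functionals `f ↦ (D(c₁) ⋯ D(c_M) f)(w)` with points `w ∈ P` and directions
in `Q`. -/
noncomputable def pointFunctionals (P Q : Set (ℕ → ℂ)) : Submodule ℂ (Module.Dual ℂ Poly) :=
  Submodule.span ℂ {F | ∃ w ∈ P, ∃ cs : List (ℕ → ℂ), (∀ c ∈ cs, c ∈ Q) ∧ F = evalIterDeriv w cs}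

theorem evalIterDeriv_mem {P Q : Set (ℕ → ℂ)} {w : ℕ → ℂ} (hw : w ∈ P) {cs : List (ℕ → ℂ)}
    (hcs : ∀ c ∈ cs, c ∈ Q) : evalIterDeriv w cs ∈ pointFunctionals P Q :=
  Submodule.subset_span ⟨w, hw, cs, hcs, rfl⟩

theorem comp_dirDerivation_mem {P Q : Set (ℕ → ℂ)} {c : ℕ → ℂ} (hc : c ∈ Q)
    {F : Module.Dual ℂ Poly} (hF : F ∈ pointFunctionals P Q) :
    F ∘ₗ (dirDerivation c : Poly →ₗ[ℂ] Poly) ∈ pointFunctionals P Q := by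
  induction hF using Submodule.span_induction with
  | mem F h =>
    obtain ⟨w, hw, cs, hcs, rfl⟩ := h
    have : evalIterDeriv w cs ∘ₗ (dirDerivation c : Poly →ₗ[ℂ] Poly)
        = evalIterDeriv w (cs ++ [c]) := by
      refine LinearMap.ext fun f => ?_
      simp [evalIterDeriv_apply, iterDeriv_concat]
    rw [this]
    refine evalIterDeriv_mem hw fun d hd => ?_
    rcases List.mem_append.mp hd with hd | hd
    · exact hcs d hd
    · rwa [List.mem_singleton.mp hd]
  | zero => simp
  | add F G _ _ hF hG => rw [LinearMap.add_comp]; exact add_mem hF hG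
  | smul a F _ hF => rw [LinearMap.smul_comp]; exact Submodule.smul_mem _ a hF

/-- A multiple of a functional `f ↦ (D(c₁) ⋯ D(c_M) f)(w)` is given by a single factorizable
operator. -/
theorem exists_factorizableOp_smul {Q : Set (ℕ → ℂ)} (hQ : ∀ (a : ℂ), ∀ c ∈ Q, a • c ∈ Q)
    (a : ℂ) (cs : List (ℕ → ℂ)) (hcs : ∀ c ∈ cs, c ∈ Q) :
    ∃ D : FactorizableOp, (∀ c ∈ D.directions, c ∈ Q) ∧ ∀ f, D.apply f = a • iterDeriv cs f := by
  by_cases h : a = 0 ∨ (0 : ℕ → ℂ) ∈ cs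
  -- `prod` admits no zero direction, so the zero operator has to be written as a constant.
  · refine ⟨.const 0, by simp [FactorizableOp.directions], fun f => ?_⟩
    rcases h with rfl | h
    · simp [FactorizableOp.apply]
    · simp [FactorizableOp.apply, iterDeriv_eq_zero_of_mem h]
  push Not at h
  obtain ⟨ha, h0⟩ := h
  cases cs with
  | nil => exact ⟨.const a, by simp [FactorizableOp.directions], fun f => rfl⟩
  | cons c cs =>
    have hc0 : c ≠ 0 := fun h => h0 (by simp [h])
    have hcs0 : ∀ d ∈ cs, d ≠ 0 := fun d hd h => h0 (by simp [← h, hd])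
    -- The scalar is absorbed into the first direction; this is where `Q` must be closed under
    -- scaling.
    refine ⟨.prod ((a • c) :: cs) ?_, ?_, fun f => ?_⟩
    · intro d hd
      rcases List.mem_cons.mp hd with rfl | hd
      · exact smul_ne_zero ha hc0
      · exact hcs0 d hd
    · intro d hd
      rcases List.mem_cons.mp hd with rfl | hd
      · exact hQ a c (hcs c (by simp))
      · exact hcs d (by simp [hd])
    · change ((a • c) :: cs).foldr dirDeriv f = _
      rw [← iterDeriv_eq_foldr, iterDeriv_cons, iterDeriv_cons, dirDerivation_smul]

theorem mem_pointFunctionals_iff {P Q : Set (ℕ → ℂ)} (hQ : ∀ (a : ℂ), ∀ c ∈ Q, a • c ∈ Q)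
    (F : Module.Dual ℂ Poly) :
    F ∈ pointFunctionals P Q ↔
      ∃ (L : ℕ) (D : Fin L → FactorizableOp) (lam : Fin L → ℕ → ℂ),
        (∀ f, F f = ∑ l, eval (lam l) ((D l).apply f)) ∧
        ∀ l, lam l ∈ P ∧ ∀ c ∈ (D l).directions, c ∈ Q := by
  constructor
  · intro h
    obtain ⟨L, a, G, rfl⟩ := Submodule.mem_span_set'.mp h
    choose w hw cs hcs hG using fun l => (G l).2
    choose D hD hDf using fun l => exists_factorizableOp_smul hQ (a l) (cs l) (hcs l)
    refine ⟨L, D, w, fun f => ?_, fun l => ⟨hw l, hD l⟩⟩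
    simp [hG, hDf, evalIterDeriv_apply, smul_eval]
  · rintro ⟨L, D, lam, hF, h⟩
    have key : ∀ l, ∃ G ∈ pointFunctionals P Q, ∀ f, G f = eval (lam l) ((D l).apply f) := by
      intro l
      obtain ⟨hl, hd⟩ := h l
      revert hd
      cases D l with
      | const a =>
        intro _
        refine ⟨a • evalIterDeriv (lam l) [],
          Submodule.smul_mem _ _ (evalIterDeriv_mem hl (by simp)), fun f => ?_⟩
        simp [evalIterDeriv_apply, FactorizableOp.apply, iterDeriv_nil, smul_eval]
      | prod cs hcs =>
        intro hd
        refine ⟨evalIterDeriv (lam l) cs, evalIterDeriv_mem hl hd, fun f => ?_⟩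
        rw [evalIterDeriv_apply, iterDeriv_eq_foldr, FactorizableOp.apply]
    choose G hG hGf using key
    have : F = ∑ l, G l := by
      refine LinearMap.ext fun f => ?_
      simp only [hF, LinearMap.sum_apply, hGf]
    rw [this]
    exact sum_mem fun l _ => hG l

/-! ### The Leibniz rule and finite rank -/

theorem exists_leibniz_expansion (cs : List (ℕ → ℂ)) :
    ∃ (ι : Type) (_ : Fintype ι) (a b : ι → List (ℕ → ℂ)),
      (∀ i, (∀ c ∈ a i, c ∈ cs) ∧ ∀ c ∈ b i, c ∈ cs) ∧
      ∀ f g, iterDeriv cs (f * g) = ∑ i, iterDeriv (a i) f * iterDeriv (b i) g := by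
  induction cs with
  | nil =>
    exact ⟨Unit, inferInstance, fun _ => [], fun _ => [], by simp, fun f g => by
      simp [iterDeriv_nil]⟩
  | cons c cs ih =>
    obtain ⟨ι, _, a, b, hab, h⟩ := ih
    refine ⟨ι ⊕ ι, inferInstance, Sum.elim (fun i => c :: a i) a, Sum.elim b (fun i => c :: b i),
      ?_, fun f g => ?_⟩
    · rintro (i | i)
      · refine ⟨fun d hd => ?_, fun d hd => List.mem_cons_of_mem _ ((hab i).2 d hd)⟩
        rcases List.mem_cons.mp hd with rfl | hd
        · simp
        · exact List.mem_cons_of_mem _ ((hab i).1 d hd)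
      · refine ⟨fun d hd => List.mem_cons_of_mem _ ((hab i).1 d hd), fun d hd => ?_⟩
        rcases List.mem_cons.mp hd with rfl | hd
        · simp
        · exact List.mem_cons_of_mem _ ((hab i).2 d hd)
    · rw [iterDeriv_cons, h, map_sum, Fintype.sum_sum_type, ← Finset.sum_add_distrib]
      refine Finset.sum_congr rfl fun i _ => ?_
      simp only [Sum.elim_inl, Sum.elim_inr, iterDeriv_cons, Derivation.leibniz, smul_eq_mul]
      ring

/-- For `F` in the span of point functionals, `(f, g) ↦ F (f * g)` has finite rank, with factors
in the same span. -/
theorem exists_sum_mul_of_mem_pointFunctionals {P Q : Set (ℕ → ℂ)} {F : Module.Dual ℂ Poly}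
    (hF : F ∈ pointFunctionals P Q) :
    ∃ (ι : Type) (_ : Fintype ι) (G H : ι → Module.Dual ℂ Poly),
      (∀ i, G i ∈ pointFunctionals P Q ∧ H i ∈ pointFunctionals P Q) ∧
      ∀ f g, F (f * g) = ∑ i, G i f * H i g := by
  induction hF using Submodule.span_induction with
  | mem F h =>
    obtain ⟨w, hw, cs, hcs, rfl⟩ := h
    obtain ⟨ι, _, a, b, hab, h⟩ := exists_leibniz_expansion cs
    refine ⟨ι, inferInstance, fun i => evalIterDeriv w (a i), fun i => evalIterDeriv w (b i),
      fun i => ⟨evalIterDeriv_mem hw fun c hc => hcs c ((hab i).1 c hc),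
        evalIterDeriv_mem hw fun c hc => hcs c ((hab i).2 c hc)⟩, fun f g => ?_⟩
    simp [evalIterDeriv_apply, h]
  | zero => exact ⟨Empty, inferInstance, Empty.elim, Empty.elim, by simp, by simp⟩
  | add F₁ F₂ _ _ h₁ h₂ =>
    obtain ⟨ι₁, _, G₁, H₁, hm₁, e₁⟩ := h₁
    obtain ⟨ι₂, _, G₂, H₂, hm₂, e₂⟩ := h₂
    refine ⟨ι₁ ⊕ ι₂, inferInstance, Sum.elim G₁ G₂, Sum.elim H₁ H₂, ?_, fun f g => ?_⟩
    · rintro (i | i)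
      · exact hm₁ i
      · exact hm₂ i
    · simp [e₁, e₂]
  | smul a F _ h =>
    obtain ⟨ι, _, G, H, hm, e⟩ := h
    refine ⟨ι, inferInstance, fun i => a • G i, H,
      fun i => ⟨Submodule.smul_mem _ _ (hm i).1, (hm i).2⟩, fun f g => ?_⟩
    simp [e, Finset.mul_sum, mul_assoc]

/-! ### Functionals factoring through a finite-dimensional algebra -/

section FiniteDimensional

variable {A : Type*} [CommRing A] [Algebra ℂ A]

/-- The residue field is a finite extension of the algebraically closed field ℂ, hence ℂ itself. -/
theorem exists_algHom_ker_eq [Module.Finite ℂ A] (M : Ideal A) [hM : M.IsMaximal] :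
    ∃ χ : A →ₐ[ℂ] ℂ, RingHom.ker χ = M := by
  let _ : Field (A ⧸ M) := Ideal.Quotient.field M
  have hb : Function.Bijective (algebraMap ℂ (A ⧸ M)) :=
    IsAlgClosed.algebraMap_bijective_of_isIntegral
  let e : ℂ ≃ₐ[ℂ] (A ⧸ M) := AlgEquiv.ofBijective (Algebra.ofId ℂ (A ⧸ M)) hb
  refine ⟨(e.symm : (A ⧸ M) →ₐ[ℂ] ℂ).comp (Ideal.Quotient.mkₐ ℂ M), ?_⟩
  ext a
  simp [RingHom.mem_ker, Ideal.Quotient.eq_zero_iff_mem]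

/-- A finite-dimensional algebra is generated, as an ideal, by the annihilators of powers of
kernels of characters. -/
theorem eq_top_of_annihilator_pow_ker_le [Module.Finite ℂ A] (K : Ideal A)
    (hK : ∀ (χ : A →ₐ[ℂ] ℂ) (N : ℕ), (RingHom.ker χ ^ N).annihilator ≤ K) : K = ⊤ := by
  classical
  have : IsArtinianRing A := IsArtinianRing.of_finite ℂ A
  by_contra hne
  obtain ⟨M, hM, hKM⟩ := Ideal.exists_le_maximal K hne
  let _ : Fintype (MaximalSpectrum A) := Fintype.ofFinite _
  obtain ⟨N, hN⟩ := IsArtinianRing.isNilpotent_jacobson_bot (R := A)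
  -- The product of the maximal ideals lies in the Jacobson radical, whose `N`-th power vanishes.
  have hprod : ∏ m : MaximalSpectrum A, m.asIdeal ^ N = ⊥ := by
    rw [Finset.prod_pow, eq_bot_iff, ← Ideal.zero_eq_bot, ← hN]
    refine Ideal.pow_right_mono ?_ N
    refine Ideal.prod_le_inf.trans ?_
    rw [Ideal.jacobson]
    refine le_sInf fun J hJ => ?_
    exact Finset.inf_le (Finset.mem_univ (⟨J, hJ.2⟩ : MaximalSpectrum A))
  let m₀ : MaximalSpectrum A := ⟨M, hM⟩
  -- The product over the other maximal ideals annihilates `M ^ N`, so it lies in `K ≤ M`; primality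
  -- of `M` then puts one of those ideals inside `M`, a contradiction.
  have hle : ∏ m ∈ Finset.univ.erase m₀, m.asIdeal ^ N ≤ M := by
    refine le_trans ?_ hKM
    obtain ⟨χ, hχ⟩ := exists_algHom_ker_eq M
    refine le_trans (fun a ha => ?_) (hK χ N)
    rw [hχ, Submodule.mem_annihilator]
    intro b hb
    have : b * a ∈ ∏ m : MaximalSpectrum A, m.asIdeal ^ N := by
      rw [← Finset.mul_prod_erase _ _ (Finset.mem_univ m₀)]
      exact Ideal.mul_mem_mul hb ha
    rw [hprod, Ideal.mem_bot] at this
    rw [smul_eq_mul, mul_comm, this]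
  obtain ⟨m, hm, hmM⟩ := (hM.isPrime.prod_le).mp hle
  have hmM' : m.asIdeal ≤ M := hM.isPrime.le_of_pow_le hmM
  exact (Finset.mem_erase.mp hm).1 (MaximalSpectrum.ext (m.isMaximal.eq_of_le hM.ne_top hmM'))

variable {ι : Type*} [Fintype ι]

/-- The `k`-th differential at `w`, with values in `A`, along the directions `b i` weighted by
`e i`: `k!` times the degree `k` part of the Taylor expansion of `f (w + ∑ i, b i * e i)`. -/
noncomputable def taylorTerm (w : ℕ → ℂ) (b : ι → ℕ → ℂ) (e : ι → A) : ℕ → Poly →ₗ[ℂ] A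
  | 0 => (Algebra.linearMap ℂ A) ∘ₗ (aeval w).toLinearMap
  | k + 1 => ∑ i, (LinearMap.mulLeft ℂ (e i)) ∘ₗ taylorTerm w b e k ∘ₗ
      (dirDerivation (b i) : Poly →ₗ[ℂ] Poly)

theorem taylorTerm_zero (w : ℕ → ℂ) (b : ι → ℕ → ℂ) (e : ι → A) (f : Poly) :
    taylorTerm w b e 0 f = algebraMap ℂ A (eval w f) := by
  simp [taylorTerm, aeval_eq_eval]

theorem taylorTerm_succ (w : ℕ → ℂ) (b : ι → ℕ → ℂ) (e : ι → A) (k : ℕ) (f : Poly) :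
    taylorTerm w b e (k + 1) f = ∑ i, e i * taylorTerm w b e k (dirDerivation (b i) f) := by
  simp [taylorTerm]

theorem taylorTerm_succ_C (w : ℕ → ℂ) (b : ι → ℕ → ℂ) (e : ι → A) (k : ℕ) (a : ℂ) :
    taylorTerm w b e (k + 1) (C a) = 0 := by
  simp [taylorTerm_succ]

theorem taylorTerm_zero_X_mul (w : ℕ → ℂ) (b : ι → ℕ → ℂ) (e : ι → A) (j : ℕ) (f : Poly) :
    taylorTerm w b e 0 (X j * f) = algebraMap ℂ A (w j) * taylorTerm w b e 0 f := by
  simp [taylorTerm_zero]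

/-- Any one of the `k + 1` differentiations may fall on `X j`, and each choice contributes the same
factor `∑ i, b i j • e i`. -/
theorem taylorTerm_succ_X_mul (w : ℕ → ℂ) (b : ι → ℕ → ℂ) (e : ι → A) (k j : ℕ) (f : Poly) :
    taylorTerm w b e (k + 1) (X j * f) = algebraMap ℂ A (w j) * taylorTerm w b e (k + 1) f
      + (k + 1) * (∑ i, b i j • e i) * taylorTerm w b e k f := by
  induction k generalizing f with
  | zero =>
    rw [taylorTerm_succ, taylorTerm_succ, Finset.mul_sum, Nat.cast_zero, zero_add, one_mul,
      Finset.sum_mul, ← Finset.sum_add_distrib]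
    refine Finset.sum_congr rfl fun i _ => ?_
    rw [dirDerivation_X_mul, map_add, map_smul, taylorTerm_zero_X_mul, Algebra.smul_def,
      Algebra.smul_def]
    ring
  | succ k ih =>
    have h : ∀ i, e i * taylorTerm w b e (k + 1) (dirDerivation (b i) (X j * f)) =
        (b i j • e i) * taylorTerm w b e (k + 1) f
        + algebraMap ℂ A (w j) * (e i * taylorTerm w b e (k + 1) (dirDerivation (b i) f))
        + (k + 1) * (∑ i, b i j • e i) * (e i * taylorTerm w b e k (dirDerivation (b i) f)) := by
      intro i
      rw [dirDerivation_X_mul, map_add, map_smul, ih, Algebra.smul_def (b i j),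
        Algebra.smul_def (b i j) (e i)]
      ring
    rw [taylorTerm_succ, Finset.sum_congr rfl fun i _ => h i, Finset.sum_add_distrib,
      Finset.sum_add_distrib, ← Finset.sum_mul, ← Finset.mul_sum, ← Finset.mul_sum,
      ← taylorTerm_succ, ← taylorTerm_succ]
    push_cast
    ring

theorem taylorTerm_mem_pow (w : ℕ → ℂ) (b : ι → ℕ → ℂ) {e : ι → A} {J : Ideal A}
    (he : ∀ i, e i ∈ J) (k : ℕ) (f : Poly) : taylorTerm w b e k f ∈ J ^ k := by
  induction k generalizing f with
  | zero => simp
  | succ k ih =>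
    rw [taylorTerm_succ, pow_succ']
    exact sum_mem fun i _ => Ideal.mul_mem_mul (he i) (ih _)

/-- Multiplication by `e i` is absorbed into `η`, which is why the induction must range over all
`η`. -/
theorem comp_taylorTerm_mem {P Q : Set (ℕ → ℂ)} {w : ℕ → ℂ} (hw : w ∈ P) {b : ι → ℕ → ℂ}
    (hb : ∀ i, b i ∈ Q) (e : ι → A) (k : ℕ) (η : Module.Dual ℂ A) :
    η ∘ₗ taylorTerm w b e k ∈ pointFunctionals P Q := by
  induction k generalizing η with
  | zero =>
    have : η ∘ₗ taylorTerm w b e 0 = η 1 • evalIterDeriv w [] := by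
      refine LinearMap.ext fun f => ?_
      simp [taylorTerm_zero, evalIterDeriv_apply, iterDeriv_nil, Algebra.algebraMap_eq_smul_one,
        mul_comm]
    rw [this]
    exact Submodule.smul_mem _ _ (evalIterDeriv_mem hw (by simp))
  | succ k ih =>
    have : η ∘ₗ taylorTerm w b e (k + 1) = ∑ i, ((η ∘ₗ LinearMap.mulLeft ℂ (e i)) ∘ₗ
        taylorTerm w b e k) ∘ₗ (dirDerivation (b i) : Poly →ₗ[ℂ] Poly) := by
      refine LinearMap.ext fun f => ?_
      simp [taylorTerm_succ]
    rw [this]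
    exact sum_mem fun i _ => comp_dirDerivation_mem (hb i) (ih _)

/-- Taylor expansion at `w` of a polynomial in elements of the form `w j + ∑ i, b i j * e i`,
applied to an element annihilated by the `N`-th power of an ideal containing all `e i`. -/
theorem mul_algHom_eq_sum_taylorTerm {w : ℕ → ℂ} {b : ι → ℕ → ℂ} {e : ι → A} {J : Ideal A}
    (he : ∀ i, e i ∈ J) (π : Poly →ₐ[ℂ] A)
    (hπ : ∀ j, π (X j) = algebraMap ℂ A (w j) + ∑ i, b i j • e i) {N : ℕ} {u : A}
    (hu : u ∈ (J ^ N).annihilator) (f : Poly) :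
    u * π f = ∑ k ∈ Finset.range N, ((k.factorial : ℂ)⁻¹) • (u * taylorTerm w b e k f) := by
  have hzero : ∀ g, u * taylorTerm w b e N g = 0 := fun g => by
    rw [← smul_eq_mul]
    exact Submodule.mem_annihilator.mp hu _ (taylorTerm_mem_pow w b he N g)
  induction f using MvPolynomial.induction_on with
  | C a =>
    cases N with
    | zero =>
      have hu0 : u = 0 := by simpa using Submodule.mem_annihilator.mp hu 1 (by simp)
      simp [hu0]
    | succ N =>
      rw [Finset.sum_range_succ', Finset.sum_eq_zero fun k _ => by simp [taylorTerm_succ_C]]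
      have : π (C a) = algebraMap ℂ A a := π.commutes a
      simp [taylorTerm_zero, this]
  | add f g hf hg => simp only [map_add, mul_add, hf, hg, smul_add, Finset.sum_add_distrib]
  | mul_X f j hf =>
    cases N with
    | zero =>
      have hu0 : u = 0 := by simpa using Submodule.mem_annihilator.mp hu 1 (by simp)
      simp [hu0]
    | succ N =>
      set h := ∑ i, b i j • e i with hh
      -- Multiplication by `h` raises the order of a term by one; the top term then lands in `J ^ (N
      -- + 1)`, which `u` kills.
      have hlast : h * (u * taylorTerm w b e N f) = 0 := by
        have hx : h * taylorTerm w b e N f ∈ J ^ (N + 1) := by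
          rw [pow_succ']
          refine Ideal.mul_mem_mul (sum_mem fun i _ => ?_) (taylorTerm_mem_pow w b he N f)
          rw [Algebra.smul_def]
          exact J.mul_mem_left _ (he i)
        have := Submodule.mem_annihilator.mp hu _ hx
        rw [smul_eq_mul] at this
        rw [← this]
        ring
      have hterm : ∀ k, ((k + 1).factorial : ℂ)⁻¹ • (u * taylorTerm w b e (k + 1) (X j * f)) =
          algebraMap ℂ A (w j) *
            (((k + 1).factorial : ℂ)⁻¹ • (u * taylorTerm w b e (k + 1) f))
          + h * ((k.factorial : ℂ)⁻¹ • (u * taylorTerm w b e k f)) := by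
        intro k
        have hc : (k.factorial : ℂ)⁻¹ = ((k + 1).factorial : ℂ)⁻¹ * (k + 1) := by
          rw [Nat.factorial_succ]
          have : (k : ℂ) + 1 ≠ 0 := Nat.cast_add_one_ne_zero k
          have : (k.factorial : ℂ) ≠ 0 := Nat.cast_ne_zero.mpr k.factorial_ne_zero
          push_cast
          field_simp
        rw [taylorTerm_succ_X_mul, ← hh, hc]
        simp only [Algebra.smul_def, map_mul, map_add, map_natCast, map_one]
        ring
      rw [mul_comm f, map_mul, hπ, Finset.sum_range_succ', Finset.sum_congr rfl fun k _ => hterm k,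
        taylorTerm_zero_X_mul, Finset.sum_add_distrib, ← Finset.mul_sum, ← Finset.mul_sum]
      have h1 := Finset.sum_range_succ'
        (fun k => ((k.factorial : ℂ)⁻¹) • (u * taylorTerm w b e k f)) N
      have h2 := Finset.sum_range_succ
        (fun k => ((k.factorial : ℂ)⁻¹) • (u * taylorTerm w b e k f)) N
      rw [← hf] at h1 h2
      have h3 : h * ((N.factorial : ℂ)⁻¹ • (u * taylorTerm w b e N f)) = 0 := by
        rw [mul_smul_comm, hlast, smul_zero]
      have h4 : h * ∑ k ∈ Finset.range N, ((k.factorial : ℂ)⁻¹) • (u * taylorTerm w b e k f)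
          = h * (u * π f) := by
        rw [h2, mul_add, h3, add_zero]
      rw [h4]
      have h5 : algebraMap ℂ A (w j) * (u * π f) = _ := congrArg (algebraMap ℂ A (w j) * ·) h1
      simp only [Nat.factorial_zero, Nat.cast_one, inv_one, one_smul] at h5 ⊢
      linear_combination h5

/-- Every functional on `ℂ[z]` that factors through a finite-dimensional algebra is a combination
of derivatives at points. -/
theorem comp_algHom_mem_pointFunctionals [Module.Finite ℂ A] {P Q : Set (ℕ → ℂ)}
    (π : Poly →ₐ[ℂ] A) (hP : ∀ χ : A →ₐ[ℂ] ℂ, (fun j => χ (π (X j))) ∈ P)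
    (hQ : ∀ ξ : Module.Dual ℂ A, (fun j => ξ (π (X j))) ∈ Q) (η : Module.Dual ℂ A) :
    η ∘ₗ π.toLinearMap ∈ pointFunctionals P Q := by
  -- It suffices that `1 ∈ K`. Quantifying over all `η` makes `K` an ideal, since a multiplication
  -- can be moved into `η`.
  let K : Ideal A :=
    { carrier := {u | ∀ η : Module.Dual ℂ A,
        (η ∘ₗ LinearMap.mulLeft ℂ u) ∘ₗ π.toLinearMap ∈ pointFunctionals P Q}
      add_mem' := fun {u v} hu hv η => by
        have : (η ∘ₗ LinearMap.mulLeft ℂ (u + v)) ∘ₗ π.toLinearMap =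
            (η ∘ₗ LinearMap.mulLeft ℂ u) ∘ₗ π.toLinearMap +
            (η ∘ₗ LinearMap.mulLeft ℂ v) ∘ₗ π.toLinearMap := by
          refine LinearMap.ext fun f => ?_
          simp [add_mul]
        rw [this]
        exact add_mem (hu η) (hv η)
      zero_mem' := fun η => by simp
      smul_mem' := fun a u hu η => by
        have : (η ∘ₗ LinearMap.mulLeft ℂ (a • u)) ∘ₗ π.toLinearMap =
            ((η ∘ₗ LinearMap.mulLeft ℂ a) ∘ₗ LinearMap.mulLeft ℂ u) ∘ₗ π.toLinearMap := by
          refine LinearMap.ext fun f => ?_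
          simp
        rw [this]
        exact hu _ }
  have hK : K = ⊤ := by
    refine eq_top_of_annihilator_pow_ker_le K fun χ N u hu η => ?_
    -- Shifting a basis by its values under `χ` gives a spanning set of `ker χ`; the coordinates of
    -- `π (X j)` supply the directions.
    let v := Module.finBasis ℂ A
    let e : Fin (Module.finrank ℂ A) → A := fun i => v i - algebraMap ℂ A (χ (v i))
    have he : ∀ i, e i ∈ RingHom.ker χ := fun i => by simp [e, RingHom.mem_ker]
    have hsum : ∀ a : A, a = algebraMap ℂ A (χ a) + ∑ i, v.coord i a • e i := by
      intro a
      have h1 : ∑ i, v.coord i a • v i = a := v.sum_repr a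
      have h2 : ∑ i, v.coord i a • algebraMap ℂ A (χ (v i)) = algebraMap ℂ A (χ a) := by
        conv_rhs => rw [← h1]
        simp [Algebra.smul_def]
      simp only [e, smul_sub, Finset.sum_sub_distrib, h1, h2]
      ring
    have key : (η ∘ₗ LinearMap.mulLeft ℂ u) ∘ₗ π.toLinearMap =
        ∑ k ∈ Finset.range N, ((k.factorial : ℂ)⁻¹) • ((η ∘ₗ LinearMap.mulLeft ℂ u) ∘ₗ
          taylorTerm (fun j => χ (π (X j))) (fun i j => v.coord i (π (X j))) e k) := by
      refine LinearMap.ext fun f => ?_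
      have := mul_algHom_eq_sum_taylorTerm he π (fun j => hsum (π (X j))) hu f
      simpa using congrArg η this
    rw [key]
    exact sum_mem fun k _ => Submodule.smul_mem _ _
      (comp_taylorTerm_mem (hP χ) (fun i => hQ (v.coord i)) e k _)
  have h1 : (1 : A) ∈ K := hK ▸ Submodule.mem_top
  simpa using h1 η

end FiniteDimensional

/-! ### Multi-indices and positive integers -/

theorem toNat_zero : toNat 0 = 1 := Finsupp.prod_zero_index

theorem toNat_add (κ κ' : ℕ →₀ ℕ) : toNat (κ + κ') = toNat κ * toNat κ' :=
  Finsupp.prod_add_index' (by simp) (by simp [pow_add])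

theorem toNat_single (j k : ℕ) : toNat (Finsupp.single j k) = prime j ^ k :=
  Finsupp.prod_single_index (by simp)

theorem toNat_surjective : Function.Surjective toNat := by
  have h : ∀ n : ℕ, ∀ hn : 0 < n, ∃ κ, toNat κ = ⟨n, hn⟩ := by
    intro n
    induction n using Nat.recOnMul with
    | zero => exact fun hn => absurd hn (lt_irrefl 0)
    | one => exact fun hn => ⟨0, toNat_zero⟩
    | prime p hp =>
      intro hn
      refine ⟨Finsupp.single (Nat.count Nat.Prime p) 1, ?_⟩
      rw [toNat_single, pow_one]
      exact Subtype.ext (Nat.nth_count hp)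
    | mul a b iha ihb =>
      intro hn
      obtain ⟨κ, hκ⟩ := iha (Nat.pos_of_mul_pos_right hn)
      obtain ⟨κ', hκ'⟩ := ihb (Nat.pos_of_mul_pos_left hn)
      exact ⟨κ + κ', by rw [toNat_add, hκ, hκ']; rfl⟩
  exact fun n => h n n.pos

theorem prime_injective : Function.Injective prime := fun _ _ h =>
  Nat.nth_injective Nat.infinite_setOfPred_prime (congrArg PNat.val h)

/-- The multi-index of a positive integer. -/
noncomputable def exponents (n : ℕ+) : ℕ →₀ ℕ := Function.surjInv toNat_surjective n

theorem toNat_exponents (n : ℕ+) : toNat (exponents n) = n :=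
  Function.surjInv_eq toNat_surjective n

/-! ### Majorants and Cauchy-type estimates -/

/-- The value `r^κ` of a monomial at a real point. -/
noncomputable def monoVal (r : ℕ → ℝ) (κ : ℕ →₀ ℕ) : ℝ := κ.prod fun j k => r j ^ k

theorem monoVal_zero (r : ℕ → ℝ) : monoVal r 0 = 1 := Finsupp.prod_zero_index

theorem monoVal_add (r : ℕ → ℝ) (κ κ' : ℕ →₀ ℕ) :
    monoVal r (κ + κ') = monoVal r κ * monoVal r κ' :=
  Finsupp.prod_add_index' (by simp) (by simp [pow_add])

theorem monoVal_single (r : ℕ → ℝ) (j k : ℕ) : monoVal r (Finsupp.single j k) = r j ^ k :=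
  Finsupp.prod_single_index (by simp)

theorem monoVal_nonneg {r : ℕ → ℝ} (hr : ∀ j, 0 ≤ r j) (κ : ℕ →₀ ℕ) : 0 ≤ monoVal r κ :=
  Finset.prod_nonneg fun j _ => pow_nonneg (hr j) _

theorem monoVal_mono {r s : ℕ → ℝ} (hr : ∀ j, 0 ≤ r j) (hrs : ∀ j, r j ≤ s j) (κ : ℕ →₀ ℕ) :
    monoVal r κ ≤ monoVal s κ :=
  Finset.prod_le_prod (fun j _ => pow_nonneg (hr j) _)
    fun j _ => pow_le_pow_left₀ (hr j) (hrs j) _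

theorem monoVal_sq (r : ℕ → ℝ) (κ : ℕ →₀ ℕ) :
    monoVal r κ ^ 2 = monoVal (fun j => r j ^ 2) κ := by
  rw [monoVal, monoVal, Finsupp.prod, Finsupp.prod, ← Finset.prod_pow]
  exact Finset.prod_congr rfl fun j _ => pow_right_comm _ _ _

/-- Induction on multi-indices, raising one exponent by one at a time. -/
theorem multiIndex_induction {p : (ℕ →₀ ℕ) → Prop} (zero : p 0)
    (step : ∀ j κ, p κ → p (Finsupp.single j 1 + κ)) (κ : ℕ →₀ ℕ) : p κ := by
  induction κ using Finsupp.induction with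
  | zero => exact zero
  | single_add j k κ _ _ h =>
    clear * - step h
    induction k with
    | zero => simpa using h
    | succ k ih =>
      rw [add_comm k 1, Finsupp.single_add, add_assoc]
      exact step j _ ih

/-- The value at `r` of the polynomial whose coefficients are the moduli of those of `f`. -/
noncomputable def majorant (r : ℕ → ℝ) (f : Poly) : ℝ :=
  ∑ κ ∈ f.support, ‖f.coeff κ‖ * monoVal r κ

theorem majorant_eq_sum (r : ℕ → ℝ) {f : Poly} {s : Finset (ℕ →₀ ℕ)} (hs : f.support ⊆ s) :
    majorant r f = ∑ κ ∈ s, ‖f.coeff κ‖ * monoVal r κ :=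
  Finset.sum_subset hs fun κ _ hκ => by simp [notMem_support_iff.mp hκ]

theorem majorant_monomial (r : ℕ → ℝ) (κ : ℕ →₀ ℕ) (a : ℂ) :
    majorant r (monomial κ a) = ‖a‖ * monoVal r κ := by
  classical
  rw [majorant_eq_sum r support_monomial_subset, Finset.sum_singleton, coeff_monomial, if_pos rfl]

theorem majorant_zero (r : ℕ → ℝ) : majorant r 0 = 0 := by simp [majorant]

theorem majorant_add_le {r : ℕ → ℝ} (hr : ∀ j, 0 ≤ r j) (f g : Poly) :
    majorant r (f + g) ≤ majorant r f + majorant r g := by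
  classical
  rw [majorant_eq_sum r support_add, majorant_eq_sum r (f := f) Finset.subset_union_left,
    majorant_eq_sum r (f := g) Finset.subset_union_right, ← Finset.sum_add_distrib]
  refine Finset.sum_le_sum fun κ _ => ?_
  rw [coeff_add, ← add_mul]
  exact mul_le_mul_of_nonneg_right (norm_add_le _ _) (monoVal_nonneg hr κ)

theorem majorant_sum_le {r : ℕ → ℝ} (hr : ∀ j, 0 ≤ r j) {ι : Type*} (s : Finset ι)
    (f : ι → Poly) : majorant r (∑ i ∈ s, f i) ≤ ∑ i ∈ s, majorant r (f i) :=
  Finset.le_sum_of_subadditive _ (majorant_zero r).le (majorant_add_le hr) s f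

theorem majorant_smul (r : ℕ → ℝ) (a : ℂ) (f : Poly) :
    majorant r (a • f) = ‖a‖ * majorant r f := by
  rw [majorant_eq_sum r (support_smul (a := a) (f := f)), majorant, Finset.mul_sum]
  exact Finset.sum_congr rfl fun κ _ => by rw [coeff_smul, smul_eq_mul, norm_mul, mul_assoc]

/-- A linear map is bounded with respect to majorants once it is bounded on monomials. -/
theorem majorant_map_le {r : ℕ → ℝ} (hr : ∀ j, 0 ≤ r j) {s : ℕ → ℝ} {C : ℝ}
    (T : Poly →ₗ[ℂ] Poly) (hT : ∀ κ, majorant r (T (monomial κ 1)) ≤ C * monoVal s κ) (f : Poly) :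
    majorant r (T f) ≤ C * majorant s f := by
  have hf : T f = ∑ κ ∈ f.support, f.coeff κ • T (monomial κ 1) := by
    conv_lhs => rw [f.as_sum]
    rw [map_sum]
    refine Finset.sum_congr rfl fun κ _ => ?_
    rw [← map_smul, smul_monomial, smul_eq_mul, mul_one]
  rw [hf, majorant.eq_1 s f, Finset.mul_sum]
  refine (majorant_sum_le hr _ _).trans (Finset.sum_le_sum fun κ _ => ?_)
  rw [majorant_smul, mul_left_comm]
  exact mul_le_mul_of_nonneg_left (hT κ) (norm_nonneg _)

theorem majorant_X_mul_le {r : ℕ → ℝ} (hr : ∀ j, 0 ≤ r j) (j : ℕ) (f : Poly) :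
    majorant r (X j * f) ≤ r j * majorant r f := by
  refine majorant_map_le hr (LinearMap.mulLeft ℂ (X j)) (fun κ => ?_) f
  rw [LinearMap.mulLeft_apply, X, monomial_mul, majorant_monomial, monoVal_add, monoVal_single]
  simp

theorem norm_eval_le_majorant (w : ℕ → ℂ) (f : Poly) :
    ‖eval w f‖ ≤ majorant (fun j => ‖w j‖) f := by
  rw [eval_eq, majorant]
  refine (norm_sum_le _ _).trans (le_of_eq (Finset.sum_congr rfl fun κ _ => ?_))
  rw [norm_mul, norm_prod, monoVal, Finsupp.prod]
  simp only [norm_pow]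

/-- For non-negative coefficients, `t` times the derivative along |c| is the first-order part of the
expansion at `r + t|c|`, whose remaining terms are non-negative. -/
theorem majorant_dirDerivation_le {r : ℕ → ℝ} (hr : ∀ j, 0 ≤ r j) (c : ℕ → ℂ) {t : ℝ}
    (ht : 0 < t) (f : Poly) :
    majorant r (dirDerivation c f) ≤ t⁻¹ * majorant (fun j => r j + t * ‖c j‖) f := by
  refine majorant_map_le hr (dirDerivation c : Poly →ₗ[ℂ] Poly) (fun κ => ?_) f
  rw [← mul_le_mul_iff_right₀ ht, mul_inv_cancel_left₀ ht.ne']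
  have hs : ∀ j, r j ≤ r j + t * ‖c j‖ := fun j => by
    have := mul_nonneg ht.le (norm_nonneg (c j))
    linarith
  induction κ using multiIndex_induction with
  | zero =>
    simp [majorant_zero, monoVal_zero]
  | step j κ ih =>
    have e : (monomial (Finsupp.single j 1 + κ) (1 : ℂ) : Poly) = X j * monomial κ 1 := by
      rw [X, monomial_mul, one_mul]
    rw [e]
    change t * majorant r (dirDerivation c (X j * monomial κ 1)) ≤ _
    change t * majorant r (dirDerivation c (monomial κ 1)) ≤ _ at ih
    rw [dirDerivation_X_mul, monoVal_add, monoVal_single, pow_one]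
    have h1 := majorant_add_le hr (c j • monomial κ 1) (X j * dirDerivation c (monomial κ 1))
    have h2 := majorant_X_mul_le hr j (dirDerivation c (monomial κ 1))
    rw [majorant_smul, majorant_monomial, norm_one, one_mul] at h1
    have h3 := mul_le_mul_of_nonneg_left (monoVal_mono hr hs κ)
      (mul_nonneg ht.le (norm_nonneg (c j)))
    have h4 := mul_le_mul_of_nonneg_left ih (hr j)
    have h5 := mul_le_mul_of_nonneg_left (h1.trans (add_le_add_right h2 _)) ht.le
    nlinarith

/-- Non-negative square summable sequences with entries less than `1`. -/
def SqSummableBall : Set (ℕ → ℝ) :=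
  {r | (∀ j, 0 ≤ r j ∧ r j < 1) ∧ Summable fun j => r j ^ 2}

/-- Square summability leaves only finitely many entries at or above 1/2. -/
theorem exists_lt_one_forall_le {r : ℕ → ℝ} (hr : r ∈ SqSummableBall) :
    ∃ ρ < 1, ∀ j, r j ≤ ρ := by
  have hfin : {j | ¬ r j ^ 2 < 1 / 4}.Finite :=
    hr.2.tendsto_cofinite_zero.eventually (gt_mem_nhds (by norm_num : (0 : ℝ) < 1 / 4))
  have hs : ∀ s : Finset ℕ, ∃ ρ < 1, ∀ j ∈ s, r j ≤ ρ := by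
    intro s
    induction s using Finset.induction_on with
    | empty => exact ⟨0, one_pos, by simp⟩
    | insert a s _ ih =>
      obtain ⟨ρ, h, h'⟩ := ih
      refine ⟨max ρ (r a), max_lt h (hr.1 a).2, fun j hj => ?_⟩
      rcases Finset.mem_insert.mp hj with rfl | hj
      · exact le_max_right _ _
      · exact (h' j hj).trans (le_max_left _ _)
  obtain ⟨ρ, h, h'⟩ := hs hfin.toFinset
  refine ⟨max ρ (1 / 2), max_lt h (by norm_num), fun j => ?_⟩
  by_cases hj : r j ^ 2 < 1 / 4
  · refine le_max_of_le_right ?_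
    nlinarith [(hr.1 j).1]
  · exact le_max_of_le_left (h' j (by simpa using hj))

theorem exists_add_mul_mem {r c : ℕ → ℝ} (hr : r ∈ SqSummableBall) (hc0 : ∀ j, 0 ≤ c j)
    (hc : Summable fun j => c j ^ 2) :
    ∃ t > 0, (fun j => r j + t * c j) ∈ SqSummableBall := by
  obtain ⟨ρ, hρ, hle⟩ := exists_lt_one_forall_le hr
  -- Since c ≤ 1 + c², `B` bounds every `c j`; then `t = (1 - ρ) / (2 * B)` uses at most half of the
  -- gap between `ρ` and 1.
  set B := 1 + ∑' j, c j ^ 2 with hB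
  have hB1 : 1 ≤ B := by
    have : 0 ≤ ∑' j, c j ^ 2 := tsum_nonneg fun j => sq_nonneg _
    linarith
  have hcB : ∀ j, c j ≤ B := fun j => by
    have := hc.le_tsum j fun i _ => sq_nonneg (c i)
    nlinarith [sq_nonneg (c j - 1)]
  have ht : 0 < (1 - ρ) / (2 * B) := div_pos (by linarith) (by linarith)
  refine ⟨(1 - ρ) / (2 * B), ht, fun j => ⟨?_, ?_⟩, ?_⟩
  · exact add_nonneg (hr.1 j).1 (mul_nonneg ht.le (hc0 j))
  · have h1 := mul_le_mul_of_nonneg_left (hcB j) ht.le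
    have h2 : (1 - ρ) / (2 * B) * B = (1 - ρ) / 2 := by
      field_simp
    linarith [hle j]
  · set t := (1 - ρ) / (2 * B)
    refine Summable.of_nonneg_of_le (fun j => sq_nonneg _) (fun j => ?_)
      ((hr.2.mul_left 2).add (hc.mul_left (2 * t ^ 2)))
    nlinarith [sq_nonneg (r j - t * c j)]

/-- Each derivative costs a small enlargement of the radii along its direction, and the ball leaves
room for finitely many of these. -/
theorem exists_majorant_iterDeriv_le (cs : List (ℕ → ℂ))
    (hcs : ∀ c ∈ cs, Summable fun j => ‖c j‖ ^ 2) {r : ℕ → ℝ} (hr : r ∈ SqSummableBall) :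
    ∃ C ≥ 0, ∃ s ∈ SqSummableBall, ∀ f, majorant r (iterDeriv cs f) ≤ C * majorant s f := by
  induction cs generalizing r with
  | nil => exact ⟨1, zero_le_one, r, hr, fun f => by rw [one_mul, iterDeriv_nil]⟩
  | cons c cs ih =>
    obtain ⟨t, ht, h⟩ := exists_add_mul_mem hr (fun j => norm_nonneg (c j)) (hcs c (by simp))
    obtain ⟨C, hC, s, hs, hle⟩ := ih (fun d hd => hcs d (by simp [hd])) h
    refine ⟨t⁻¹ * C, mul_nonneg (inv_nonneg.mpr ht.le) hC, s, hs, fun f => ?_⟩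
    rw [iterDeriv_cons, mul_assoc]
    exact (majorant_dirDerivation_le (fun j => (hr.1 j).1) c ht _).trans
      (mul_le_mul_of_nonneg_left (hle f) (inv_nonneg.mpr ht.le))

/-! ### Euler products and square summable coefficients -/

/-- The completely multiplicative function with value `x j` at the `j`-th prime. -/
noncomputable def multiplicativeExtension (x : ℕ → ℝ) : ℕ →* ℝ where
  -- The empty product would give 1 at `n = 0`, which breaks multiplicativity.
  toFun n := if n = 0 then 0 else n.factorization.prod fun p k => x (Nat.count Nat.Prime p) ^ k
  map_one' := by simp
  map_mul' m n := by
    by_cases hm : m = 0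
    · simp [hm]
    by_cases hn : n = 0
    · simp [hn]
    rw [if_neg hm, if_neg hn, if_neg (mul_ne_zero hm hn), Nat.factorization_mul hm hn]
    exact Finsupp.prod_add_index' (by simp) (by simp [pow_add])

theorem multiplicativeExtension_prime (x : ℕ → ℝ) {p : ℕ} (hp : p.Prime) :
    multiplicativeExtension x p = x (Nat.count Nat.Prime p) := by
  change (if p = 0 then 0 else p.factorization.prod _) = _
  rw [if_neg hp.ne_zero, hp.factorization, Finsupp.prod_single_index (by simp), pow_one]

theorem multiplicativeExtension_toNat (x : ℕ → ℝ) (κ : ℕ →₀ ℕ) :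
    multiplicativeExtension x (toNat κ) = monoVal x κ := by
  induction κ using multiIndex_induction with
  | zero => simp [toNat_zero, monoVal_zero]
  | step j κ ih =>
    rw [toNat_add, monoVal_add, PNat.mul_coe, map_mul, ih, toNat_single, monoVal_single, pow_one,
      pow_one]
    congr 1
    change multiplicativeExtension x (Nat.nth Nat.Prime j) = x j
    rw [multiplicativeExtension_prime x (Nat.prime_nth_prime j),
      Nat.count_nth_of_infinite Nat.infinite_setOfPred_prime]

theorem multiplicativeExtension_nonneg {x : ℕ → ℝ} (hx : ∀ j, 0 ≤ x j) (n : ℕ) :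
    0 ≤ multiplicativeExtension x n := by
  change 0 ≤ (if n = 0 then 0 else n.factorization.prod _)
  split_ifs
  · exact le_rfl
  · exact Finset.prod_nonneg fun p _ => pow_nonneg (hx _) _

/-- A finite set of integers below `N` consists of `N`-smooth numbers, whose total is a finite Euler
product; 1/(1 - x) ≤ exp(x/(1 - ρ)) bounds these products uniformly in `N`. -/
theorem summable_multiplicativeExtension {x : ℕ → ℝ} (hx : ∀ j, 0 ≤ x j) {ρ : ℝ} (hρ : ρ < 1)
    (hxρ : ∀ j, x j ≤ ρ) (hs : Summable x) :
    Summable fun n : ℕ+ => multiplicativeExtension x n := by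
  have hρ' : 0 < 1 - ρ := by linarith
  have hprod : ∀ N : ℕ, ∏ p ∈ N.primesBelow, (1 - multiplicativeExtension x p)⁻¹
      ≤ Real.exp ((1 - ρ)⁻¹ * ∑' j, x j) := by
    intro N
    have hle : ∀ j, (1 - x j)⁻¹ ≤ Real.exp ((1 - ρ)⁻¹ * x j) := fun j => by
      have h1 : 0 < 1 - x j := by linarith [hxρ j]
      have h2 : (1 - x j)⁻¹ = 1 + (1 - x j)⁻¹ * x j := by field_simp; ring
      have h3 : (1 - x j)⁻¹ ≤ (1 - ρ)⁻¹ := inv_anti₀ hρ' (by linarith [hxρ j])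
      have h4 := Real.add_one_le_exp ((1 - ρ)⁻¹ * x j)
      have h5 := mul_le_mul_of_nonneg_right h3 (hx j)
      linarith
    have hsum : ∑ p ∈ N.primesBelow, x (Nat.count Nat.Prime p) ≤ ∑' j, x j := by
      rw [← Finset.sum_image (f := x) (g := Nat.count Nat.Prime)]
      · exact hs.sum_le_tsum _ fun j _ => hx j
      · intro p hp q hq h
        exact Nat.count_injective (Nat.prime_of_mem_primesBelow hp)
          (Nat.prime_of_mem_primesBelow hq) h
    calc ∏ p ∈ N.primesBelow, (1 - multiplicativeExtension x p)⁻¹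
        ≤ ∏ p ∈ N.primesBelow, Real.exp ((1 - ρ)⁻¹ * x (Nat.count Nat.Prime p)) := by
          refine Finset.prod_le_prod (fun p hp => ?_) fun p hp => ?_
          · rw [multiplicativeExtension_prime x (Nat.prime_of_mem_primesBelow hp)]
            exact inv_nonneg.mpr (by linarith [hxρ (Nat.count Nat.Prime p)])
          · rw [multiplicativeExtension_prime x (Nat.prime_of_mem_primesBelow hp)]
            exact hle _
      _ = Real.exp ((1 - ρ)⁻¹ * ∑ p ∈ N.primesBelow, x (Nat.count Nat.Prime p)) := by
          rw [← Real.exp_sum, Finset.mul_sum]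
      _ ≤ _ := Real.exp_le_exp.mpr (mul_le_mul_of_nonneg_left hsum (inv_nonneg.mpr hρ'.le))
  refine summable_of_sum_le (c := Real.exp ((1 - ρ)⁻¹ * ∑' j, x j))
    (fun n => multiplicativeExtension_nonneg hx n) fun S => ?_
  obtain ⟨N, hN⟩ : ∃ N : ℕ, ∀ n ∈ S, (n : ℕ) < N :=
    ⟨(S.sup fun n => (n : ℕ)) + 1, fun n hn =>
      Nat.lt_succ_of_le (Finset.le_sup (f := fun n : ℕ+ => (n : ℕ)) hn)⟩
  refine le_trans ?_ (hprod N)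
  have hsmooth := (EulerProduct.summable_and_hasSum_smoothNumbers_prod_primesBelow_geometric
    (f := multiplicativeExtension x) (fun {p} hp => by
      rw [multiplicativeExtension_prime x hp, Real.norm_of_nonneg (hx _)]
      exact (hxρ _).trans_lt hρ) N).2
  let i : {n // n ∈ S} ↪ N.smoothNumbers :=
    ⟨fun n => ⟨n.1, Nat.mem_smoothNumbers_of_lt n.1.pos (hN n.1 n.2)⟩, fun a b h =>
      Subtype.ext (PNat.eq (Subtype.mk.inj h))⟩
  have := sum_le_hasSum (S.attach.map i) (fun m _ => multiplicativeExtension_nonneg hx m) hsmooth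
  rw [Finset.sum_map] at this
  rw [← Finset.sum_attach]
  exact this

theorem memℓp_two_iff {ι : Type*} {x : ι → ℂ} : Memℓp x 2 ↔ Summable fun i => ‖x i‖ ^ 2 := by
  rw [memℓp_gen_iff (by simp)]
  simp

/-- Square summable sequences with all entries in the open unit disc. -/
def discPoints : Set (ℕ → ℂ) := {w | (∀ j, ‖w j‖ < 1) ∧ Memℓp w 2}

/-- Square summable sequences. -/
def sqSummable : Set (ℕ → ℂ) := {c | Memℓp c 2}

theorem smul_mem_sqSummable (a : ℂ) (c : ℕ → ℂ) (hc : c ∈ sqSummable) : a • c ∈ sqSummable :=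
  Memℓp.const_smul hc a

/-- Derivatives at points of `𝔻^∞ ∩ ℓ²` in `ℓ²` directions have square summable coefficients. -/
theorem memℓp_of_mem_pointFunctionals {F : Module.Dual ℂ Poly}
    (hF : F ∈ pointFunctionals discPoints sqSummable) :
    Memℓp (fun n : ℕ+ => F (monomial (exponents n) 1)) 2 := by
  induction hF using Submodule.span_induction with
  | mem F h =>
    obtain ⟨w, hw, cs, hcs, rfl⟩ := h
    have hr : (fun j => ‖w j‖) ∈ SqSummableBall :=
      ⟨fun j => ⟨norm_nonneg _, hw.1 j⟩, memℓp_two_iff.mp hw.2⟩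
    obtain ⟨C, hC, s, hs, hle⟩ :=
      exists_majorant_iterDeriv_le cs (fun c hc => memℓp_two_iff.mp (hcs c hc)) hr
    obtain ⟨ρ, hρ, hsρ⟩ := exists_lt_one_forall_le hs
    have hsum := summable_multiplicativeExtension (x := fun j => s j ^ 2) (fun j => sq_nonneg _)
      hρ (fun j => by nlinarith [hsρ j, hs.1 j, (hs.1 j).1, (hs.1 j).2]) hs.2
    refine memℓp_two_iff.mpr (Summable.of_nonneg_of_le (fun n => sq_nonneg _) (fun n => ?_)
      (hsum.mul_left (C ^ 2)))
    have h1 : ‖evalIterDeriv w cs (monomial (exponents n) 1)‖ ≤ C * monoVal s (exponents n) := by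
      rw [evalIterDeriv_apply]
      refine (norm_eval_le_majorant _ _).trans ((hle _).trans (le_of_eq ?_))
      rw [majorant_monomial, norm_one, one_mul]
    have h2 := multiplicativeExtension_toNat (fun j => s j ^ 2) (exponents n)
    rw [toNat_exponents] at h2
    rw [h2, ← monoVal_sq, ← mul_pow]
    exact pow_le_pow_left₀ (norm_nonneg _) h1 2
  | zero => exact zero_memℓp
  | add F G _ _ hF hG => exact hF.add hG
  | smul a F _ hF => exact hF.const_smul a

/-! ### The symbol, the kernel ideal and the quotient algebra -/

theorem form_monomial (α : ℕ+ → ℂ) (κ κ' : ℕ →₀ ℕ) (a b : ℂ) :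
    form α (monomial κ a) (monomial κ' b) = a * b * α (toNat κ * toNat κ') := by
  classical
  by_cases ha : a = 0
  · simp [ha]
  by_cases hb : b = 0
  · simp [hb]
  simp [form, support_monomial, ha, hb]

/-- The functional `z^κ ↦ α(p^κ)`. -/
noncomputable def symbol (α : ℕ+ → ℂ) : Module.Dual ℂ Poly := (form α).flip 1

theorem form_eq_symbol_mul (α : ℕ+ → ℂ) (f g : Poly) : form α f g = symbol α (f * g) := by
  induction f using MvPolynomial.induction_on' with
  | monomial κ a =>
    induction g using MvPolynomial.induction_on' with
    | monomial κ' b =>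
      rw [monomial_mul]
      change _ = form α (monomial (κ + κ') (a * b)) (monomial 0 1)
      rw [form_monomial, form_monomial, toNat_zero, toNat_add]
      simp
    | add g h hg hh => rw [mul_add, map_add, map_add, hg, hh]
  | add f h hf hh => rw [add_mul, map_add, map_add, LinearMap.add_apply, hf, hh]

theorem isRepresentation_iff (α : ℕ+ → ℂ) {L : ℕ} (D : Fin L → FactorizableOp)
    (lam : Fin L → ℕ → ℂ) :
    IsRepresentation α D lam ↔ ∀ f, symbol α f = ∑ l, eval (lam l) ((D l).apply f) := by
  refine ⟨fun h f => ?_, fun h f g => by rw [form_eq_symbol_mul, h]⟩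
  have := h f 1
  rwa [form_eq_symbol_mul, mul_one] at this

/-- The range of the form is spanned by the finitely many right-hand Leibniz factors. -/
theorem hasFiniteRank_of_symbol_mem {α : ℕ+ → ℂ} {P Q : Set (ℕ → ℂ)}
    (h : symbol α ∈ pointFunctionals P Q) : HasFiniteRank α := by
  obtain ⟨ι, _, G, H, -, hGH⟩ := exists_sum_mul_of_mem_pointFunctionals h
  have hle : LinearMap.range (form α) ≤ Submodule.span ℂ (Set.range H) := by
    rintro _ ⟨f, rfl⟩
    have : form α f = ∑ i, G i f • H i := by
      refine LinearMap.ext fun g => ?_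
      simp [form_eq_symbol_mul, hGH]
    rw [this]
    exact sum_mem fun i _ => Submodule.smul_mem _ _ (Submodule.subset_span ⟨i, rfl⟩)
  have := FiniteDimensional.span_of_finite ℂ (Set.finite_range H)
  have : FiniteDimensional ℂ (LinearMap.range (form α)) := Submodule.finiteDimensional_of_le hle
  exact Module.Finite.equiv (form α).quotKerEquivRange.symm

theorem form_mul_left (α : ℕ+ → ℂ) (a f g : Poly) : form α (a * f) g = form α f (a * g) := by
  rw [form_eq_symbol_mul, form_eq_symbol_mul]
  congr 1
  ring

theorem form_comm (α : ℕ+ → ℂ) (f g : Poly) : form α f g = form α g f := by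
  rw [form_eq_symbol_mul, form_eq_symbol_mul, mul_comm]

/-- The kernel of a Helson form is an ideal. -/
noncomputable def kerIdeal (α : ℕ+ → ℂ) : Ideal Poly :=
  { LinearMap.ker (form α) with
    smul_mem' := fun a f hf => by
      refine LinearMap.mem_ker.mpr (LinearMap.ext fun g => ?_)
      rw [smul_eq_mul, form_mul_left, LinearMap.mem_ker.mp hf, LinearMap.zero_apply,
        LinearMap.zero_apply] }

theorem mem_kerIdeal {α : ℕ+ → ℂ} {f : Poly} : f ∈ kerIdeal α ↔ form α f = 0 := Iff.rfl

/-- For a finite rank form, the symbol is a combination of derivatives at points; the points and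
the directions inherit properties of the functionals `[f, ·]`. -/
theorem symbol_mem_of_hasFiniteRank {α : ℕ+ → ℂ} (h : HasFiniteRank α) {P Q : Set (ℕ → ℂ)}
    (hP : ∀ (f : Poly) (w : ℕ → ℂ), (∀ g, form α f g = eval w g) → w ∈ P)
    (hQ : ∀ f : Poly, (fun j => form α f (X j)) ∈ Q) :
    symbol α ∈ pointFunctionals P Q := by
  let π : Poly →ₐ[ℂ] Poly ⧸ kerIdeal α := Ideal.Quotient.mkₐ ℂ (kerIdeal α)
  have hπ : Function.Surjective π := Ideal.Quotient.mkₐ_surjective ℂ _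
  have hker : ∀ f, π f = 0 ↔ form α f = 0 := fun f =>
    Ideal.Quotient.eq_zero_iff_mem.trans mem_kerIdeal
  have hfin : Module.Finite ℂ (Poly ⧸ kerIdeal α) := by
    have : Module.Finite ℂ (Poly ⧸ LinearMap.ker (form α)) := h
    refine Module.Finite.of_surjective ((LinearMap.ker (form α)).liftQ π.toLinearMap fun f hf => ?_)
      fun a => ?_
    · exact (hker f).mpr hf
    · obtain ⟨f, rfl⟩ := hπ a
      exact ⟨Submodule.Quotient.mk f, rfl⟩
  obtain ⟨s, hs⟩ := π.toLinearMap.exists_rightInverse_of_surjective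
    (LinearMap.range_eq_top.mpr hπ)
  have hs' : ∀ a, π (s a) = a := fun a => LinearMap.congr_fun hs a
  have hsπ : ∀ f, form α (s (π f)) = form α f := fun f => by
    rw [← sub_eq_zero, ← map_sub, ← hker, map_sub, hs', sub_self]
  -- `B` is the induced form on the quotient. It is injective because the kernel has been divided
  -- out, hence by dimension onto the dual, so every functional on the quotient is some [f, ·].
  let B : (Poly ⧸ kerIdeal α) →ₗ[ℂ] Module.Dual ℂ (Poly ⧸ kerIdeal α) := (form α).compl₁₂ s s
  have hB : ∀ a g, B a (π g) = form α (s a) g := fun a g => by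
    change form α (s a) (s (π g)) = _
    rw [form_comm, hsπ, form_comm]
  have hBinj : Function.Injective B := by
    rw [injective_iff_map_eq_zero]
    intro a ha
    rw [← hs' a, hker]
    refine LinearMap.ext fun g => ?_
    rw [← hB, ha]
    rfl
  have hBsurj : Function.Surjective B :=
    (LinearMap.injective_iff_surjective_of_finrank_eq_finrank
      Subspace.dual_finrank_eq.symm).mp hBinj
  have hrep : ∀ ξ : Module.Dual ℂ (Poly ⧸ kerIdeal α), ∃ f, ∀ g, ξ (π g) = form α f g := fun ξ => by
    obtain ⟨a, rfl⟩ := hBsurj ξ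
    exact ⟨s a, hB a⟩
  have hsymbol : symbol α = (symbol α ∘ₗ s) ∘ₗ π.toLinearMap := by
    refine LinearMap.ext fun f => ?_
    change form α f 1 = form α (s (π f)) 1
    rw [hsπ]
  rw [hsymbol]
  refine comp_algHom_mem_pointFunctionals π (fun χ => ?_) (fun ξ => ?_) _
  · obtain ⟨f, hf⟩ := hrep χ.toLinearMap
    refine hP f _ fun g => ?_
    rw [← hf]
    have : χ.comp π = aeval fun j => χ (π (X j)) := by
      ext j
      simp
    have := AlgHom.congr_fun this g
    rwa [aeval_eq_eval] at this
  · obtain ⟨f, hf⟩ := hrep ξ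
    simpa only [hf] using hQ f

/-! ### Boundedness -/

/-- For a monomial `f` these are entries of one column of the matrix, without repetition; a column
is the image of a basis vector under the operator. -/
theorem memℓp_form_of_isBounded {α : ℕ+ → ℂ} (h : IsBounded α) (f : Poly) {ι : Type*}
    {κ : ι → ℕ →₀ ℕ} (hκ : Function.Injective fun i => toNat (κ i)) :
    Memℓp (fun i => form α f (monomial (κ i) 1)) 2 := by
  obtain ⟨T, hT⟩ := h
  induction f using MvPolynomial.induction_on' with
  | monomial κ' a =>
    have h1 : Summable fun n : ℕ+ => ‖α (n * toNat κ')‖ ^ 2 := by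
      have := memℓp_two_iff.mp (lp.memℓp (T (lp.single 2 (toNat κ') (1 : ℂ))))
      simpa only [hT] using this
    have h2 : Memℓp (fun i => α (toNat (κ i) * toNat κ')) 2 :=
      memℓp_two_iff.mpr (h1.comp_injective hκ)
    have h3 : (fun i => form α (monomial κ' a) (monomial (κ i) 1))
        = a • fun i => α (toNat (κ i) * toNat κ') := by
      funext i
      rw [form_monomial, mul_one, mul_comm (toNat κ'), Pi.smul_apply, smul_eq_mul]
    rw [h3]
    exact h2.const_smul a
  | add f g hf hg =>
    simp only [map_add, LinearMap.add_apply]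
    exact hf.add hg

theorem toNat_single_one_injective : Function.Injective fun j => toNat (Finsupp.single j 1) :=
  fun i j h => prime_injective (by simpa [toNat_single] using h)

theorem toNat_single_injective (j : ℕ) : Function.Injective fun k => toNat (Finsupp.single j k) := by
  intro k l h
  simp only [toNat_single] at h
  refine Nat.pow_right_injective (Nat.prime_nth_prime j).two_le ?_
  have := congrArg PNat.val h
  rwa [PNat.pow_coe, PNat.pow_coe] at this

theorem symbol_mem_of_isBounded {α : ℕ+ → ℂ} (hb : IsBounded α) (hr : HasFiniteRank α) :
    symbol α ∈ pointFunctionals discPoints sqSummable := by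
  refine symbol_mem_of_hasFiniteRank hr (fun f w hw => ⟨fun j => ?_, ?_⟩) fun f => ?_
  · have h := memℓp_two_iff.mp (memℓp_form_of_isBounded hb f (toNat_single_injective j))
    -- Testing on the powers of a single variable gives a geometric series in |w_j|².
    have h' : Summable fun k : ℕ => (‖w j‖ ^ 2) ^ k := by
      refine h.congr fun k => ?_
      rw [hw, eval_monomial]
      simp [pow_right_comm]
    rw [summable_geometric_iff_norm_lt_one, Real.norm_of_nonneg (sq_nonneg _)] at h'
    exact (sq_lt_one_iff₀ (norm_nonneg _)).mp h'
  · have h := memℓp_form_of_isBounded hb f toNat_single_one_injective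
    simpa [hw, eval_monomial] using h
  · exact memℓp_form_of_isBounded hb f toNat_single_one_injective

theorem isBounded_of_symbol_mem {α : ℕ+ → ℂ}
    (h : symbol α ∈ pointFunctionals discPoints sqSummable) : IsBounded α := by
  obtain ⟨ι, _, G, H, hm, hGH⟩ := exists_sum_mul_of_mem_pointFunctionals h
  let x : ι → lp (fun _ : ℕ+ => ℂ) 2 := fun i => ⟨_, memℓp_of_mem_pointFunctionals (hm i).1⟩
  -- The inner product is conjugate-linear in its first slot; the `star` restores the bilinear
  -- pairing with `H i`.
  let y : ι → lp (fun _ : ℕ+ => ℂ) 2 := fun i => star ⟨_, memℓp_of_mem_pointFunctionals (hm i).2⟩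
  refine ⟨∑ i, (innerSL ℂ (y i)).smulRight (x i), fun n m => ?_⟩
  have hα : α (n * m) = ∑ i, G i (monomial (exponents n) 1) * H i (monomial (exponents m) 1) := by
    rw [← hGH, ← form_eq_symbol_mul, form_monomial, toNat_exponents, toNat_exponents]
    simp
  rw [hα, _root_.sum_apply, lp.coeFn_sum, Finset.sum_apply]
  refine Finset.sum_congr rfl fun i _ => ?_
  rw [ContinuousLinearMap.smulRight_apply, innerSL_apply_apply, lp.inner_single_right,
    lp.coeFn_smul, Pi.smul_apply, smul_eq_mul, mul_comm]
  simp [x, y]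

end Helson

theorem theorem7p5 (α : ℕ+ → ℂ) :
    (Helson.HasFiniteRank α ↔
      ∃ (L : ℕ) (D : Fin L → Helson.FactorizableOp) (lam : Fin L → ℕ → ℂ),
        Helson.IsRepresentation α D lam) ∧
    ((Helson.IsBounded α ∧ Helson.HasFiniteRank α) ↔
      ∃ (L : ℕ) (D : Fin L → Helson.FactorizableOp) (lam : Fin L → ℕ → ℂ),
        Helson.IsRepresentation α D lam ∧
        ∀ l : Fin L,
          (∀ j : ℕ, ‖lam l j‖ < 1) ∧ Memℓp (lam l) 2 ∧
          ∀ c ∈ (D l).directions, Memℓp c 2) := by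
  constructor
  · have h : Helson.HasFiniteRank α ↔
        Helson.symbol α ∈ Helson.pointFunctionals Set.univ Set.univ :=
      ⟨fun h => Helson.symbol_mem_of_hasFiniteRank h (fun _ _ _ => Set.mem_univ _)
        fun _ => Set.mem_univ _, Helson.hasFiniteRank_of_symbol_mem⟩
    rw [h, Helson.mem_pointFunctionals_iff fun _ _ _ => Set.mem_univ _]
    simp [Helson.isRepresentation_iff]
  · have h : (Helson.IsBounded α ∧ Helson.HasFiniteRank α) ↔
        Helson.symbol α ∈ Helson.pointFunctionals Helson.discPoints Helson.sqSummable :=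
      ⟨fun h => Helson.symbol_mem_of_isBounded h.1 h.2,
        fun h => ⟨Helson.isBounded_of_symbol_mem h, Helson.hasFiniteRank_of_symbol_mem h⟩⟩
    rw [h, Helson.mem_pointFunctionals_iff Helson.smul_mem_sqSummable]
    simp only [Helson.isRepresentation_iff, Helson.discPoints, Helson.sqSummable,
      Set.mem_ofPred_eq, and_assoc]
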